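/- Let $V$ be a 3-dimensional real vector space with a Banach--Minkowski norm $\Phi\colon V\to[0,\infty)$. That is, $\Phi(v)=0$ if and only if $v=0$, $\Phi(tv)=t\,\Phi(v)$ for all $t\ge 0$, and $\Phi(v+w)\le\Phi(v)+\Phi(w)$ (symmetry $\Phi(-v)=\Phi(v)$ is not required); $\Phi$ is $C^\infty$ on $V\setminus\{0\}$; and $\Phi^2$ is quadratically strictly convex, i.e. the second differential $d^2_v(\Phi^2)$ is positive definite for every $v\ne 0$. Let $\Sigma=\{v\in V:\Phi(v)=1\}$ be its unit sphere and let $\mathrm{Gr}_2(V)$ be the Grassmannian of 2-dimensional linear subspaces of $V$ with its standard topology. Suppose that $\mathcal U\subset\mathrm{Gr}_2(V)$ is an open set such that for every $H\in\mathcal U$ there exists a vector $\tau_H\in V\setminus\{0\}$ which is tangent to $\Sigma$ at every point of $H\cap\Sigma$. Then for every $H\in\mathcal U$ the restriction $\Phi|_H$ is a Euclidean norm, i.e. there is an inner product $\langle\cdot,\cdot\rangle_H$ on $H$ with $\Phi(v)=\sqrt{\langle v,v\rangle_H}$ for all $v\in H$. -/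

import Mathlib

open scoped ContDiff Topology

/-- A (possibly non-symmetric) norm on a real vector space. -/
structure IsAsymNorm {V : Type*} [AddCommGroup V] [Module ℝ V] (Φ : V → ℝ) : Prop where
  nonneg : ∀ v, 0 ≤ Φ v
  eq_zero_iff : ∀ v, Φ v = 0 ↔ v = 0
  pos_homogeneous : ∀ (t : ℝ) (v : V), 0 ≤ t → Φ (t • v) = t * Φ v
  triangle : ∀ v w, Φ (v + w) ≤ Φ v + Φ w

/-- A Banach-Minkowski norm: a (possibly non-symmetric) norm, smooth outside `0`, whose square has
a positive definite second differential at every nonzero vector. The norm instance on `V` only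
supplies the canonical topology and smooth structure of the finite-dimensional space `V`; nothing
here depends on its choice. -/
structure IsBanachMinkowskiNorm {V : Type*} [NormedAddCommGroup V] [NormedSpace ℝ V]
    (Φ : V → ℝ) : Prop extends IsAsymNorm Φ where
  smooth : ContDiffOn ℝ ∞ Φ {0}ᶜ
  strictly_convex : ∀ v : V, v ≠ 0 → ∀ w : V, w ≠ 0 →
    0 < fderiv ℝ (fderiv ℝ (fun x => Φ x ^ 2)) v w w

/-- The unit sphere of `Φ`. -/
def unitSphere {V : Type*} (Φ : V → ℝ) : Set V := {v | Φ v = 1}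

/-- `τ` is tangent to `S` at `p`: it is the velocity at `p` of a curve lying in `S`. -/
def IsTangentTo {V : Type*} [NormedAddCommGroup V] [NormedSpace ℝ V]
    (S : Set V) (p τ : V) : Prop :=
  ∃ c : ℝ → V, c 0 = p ∧ (∀ᶠ t in 𝓝 (0 : ℝ), c t ∈ S) ∧ HasDerivAt c τ 0

/-- A function on a real vector space is a Euclidean norm if it is the norm associated with an
inner product. -/
def IsEuclideanNorm {E : Type*} [AddCommGroup E] [Module ℝ E] (ψ : E → ℝ) : Prop :=
  ∃ B : LinearMap.BilinForm ℝ E, (∀ x y, B x y = B y x) ∧ (∀ x, x ≠ 0 → 0 < B x x) ∧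
    ∀ x, ψ x = √(B x x)

/-- The Grassmannian of `k`-dimensional linear subspaces of `V`. -/
def Gr (k : ℕ) (V : Type*) [AddCommGroup V] [Module ℝ V] : Type _ :=
  {H : Submodule ℝ V // Module.finrank ℝ H = k}

/-- The subspace spanned by a linearly independent `k`-tuple. -/
def Gr.ofFrame {k : ℕ} {V : Type*} [AddCommGroup V] [Module ℝ V]
    (b : {b : Fin k → V // LinearIndependent ℝ b}) : Gr k V :=
  ⟨Submodule.span ℝ (Set.range b.1), by
    simpa using finrank_span_eq_card b.2⟩

/-- The standard topology of the Grassmannian: the quotient topology from the space of linearly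
independent `k`-tuples. -/
instance {k : ℕ} {V : Type*} [NormedAddCommGroup V] [NormedSpace ℝ V] :
    TopologicalSpace (Gr k V) :=
  TopologicalSpace.coinduced Gr.ofFrame inferInstance

/-! Write `f = Φ ^ 2`. Tangency says that `df_x τ = 0` for nonzero `x ∈ H`, and Euler's identity
`df_x x = 2 f x` then forces `τ ∉ H`.

Openness of the set of planes supplies a first variation. For a linear form `ν`, the planes `{x + s
ν(x) τ}` are admissible for small `s`, so the differentials of `f` along each have a common kernel
vector, which can be chosen differentiable in `s`. Differentiating at `s = 0` gives `w ∈ H` with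
`df_x w = g x * ν x`, where `g x = d²f_x(τ, τ) > 0` by convexity (`exists_apply_eq_fderiv_mul`).

The map `ν ↦ w` can be taken to be an isomorphism from the dual of `H` to `H`; its inverse is a
bilinear form `β` with `df_x = g x • β x` on `H` (`exists_bilin_of_forall_dual`). Along the ellipse
`β x x = 1` this makes `log f` have constant derivative; periodicity makes that constant zero, and
homogeneity gives `f = k β` (`eq_const_mul_of_fderiv_eq`). -/

section PlaneLemma

/-! ### Linear algebra and an ODE on the plane -/

variable {E : Type*} [NormedAddCommGroup E] [NormedSpace ℝ E]

theorem exists_eq_smul_add_smul_of_linearIndependent (hE : Module.finrank ℝ E = 2) {u v : E}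
    (h : LinearIndependent ℝ ![u, v]) (x : E) : ∃ a b : ℝ, x = a • u + b • v := by
  have hspan := h.span_eq_top_of_card_eq_finrank (by simp [hE])
  have hx : x ∈ Submodule.span ℝ (Set.range ![u, v]) := by rw [hspan]; trivial
  rw [Matrix.range_cons, Matrix.range_cons, Matrix.range_empty, Set.union_empty,
    Set.singleton_union, Submodule.mem_span_pair] at hx
  obtain ⟨a, b, hab⟩ := hx
  exact ⟨a, b, hab.symm⟩

/-- A bilinear form with positive diagonal on a plane has a basis which is orthonormal for its
symmetric part. -/
theorem exists_orthonormal_pair (hE : Module.finrank ℝ E = 2) (β : E →ₗ[ℝ] E →ₗ[ℝ] ℝ)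
    (hβ : ∀ x, x ≠ 0 → 0 < β x x) :
    ∃ u v : E, β u u = 1 ∧ β v v = 1 ∧ β u v + β v u = 0 ∧ ∀ x, ∃ a b : ℝ, x = a • u + b • v := by
  have normalize : ∀ x, x ≠ 0 → ∃ r : ℝ, r ≠ 0 ∧ β (r • x) (r • x) = 1 := by
    intro x hx
    have h := hβ x hx
    have hs := Real.sqrt_pos.2 h
    refine ⟨(√(β x x))⁻¹, inv_ne_zero hs.ne', ?_⟩
    simp only [map_smul, LinearMap.smul_apply, smul_eq_mul]
    have := Real.mul_self_sqrt h.le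
    field_simp
    linarith
  have : Module.Finite ℝ E := Module.finite_of_finrank_pos (by omega)
  let b := Module.finBasisOfFinrankEq ℝ E hE
  obtain ⟨r, hr, hu⟩ := normalize (b 0) (b.ne_zero 0)
  set u := r • b 0 with hu_def
  set w := b 1 - ((β u (b 1) + β (b 1) u) / 2) • u with hw_def
  have hw : w ≠ 0 := by
    intro h0
    have := congrArg (fun x => b.repr x 1) h0
    simp [hw_def, hu_def] at this
  obtain ⟨s, hs, hv⟩ := normalize w hw
  have huw : β u (s • w) + β (s • w) u = 0 := by
    simp only [hw_def, map_smul, map_sub, LinearMap.smul_apply, LinearMap.sub_apply, smul_eq_mul,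
      hu]
    ring
  refine ⟨u, s • w, hu, hv, huw, exists_eq_smul_add_smul_of_linearIndependent hE ?_⟩
  rw [LinearIndependent.pair_iff]
  intro a c h
  have h2 : β (a • u + c • s • w) (a • u + c • s • w) = a ^ 2 + c ^ 2 := by
    have h1 : ∀ y z : E, β (a • u + c • y) z = a * β u z + c * β y z := by simp
    have h3 : ∀ y z : E, β z (a • u + c • y) = a * β z u + c * β z y := by simp
    rw [h1, h3, h3, hu, hv]
    linear_combination a * c * huw
  rw [h] at h2
  simp only [map_zero] at h2
  constructor <;> nlinarith [sq_nonneg a, sq_nonneg c]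

/-- If the differential of a positive 2-homogeneous function on a plane is pointwise proportional
to a linear field of covectors, then the function is a quadratic form. -/
theorem eq_const_mul_of_fderiv_eq (hE : Module.finrank ℝ E = 2) {f : E → ℝ}
    (hf : ∀ x, x ≠ 0 → 0 < f x) (hhom : ∀ (t : ℝ) x, 0 ≤ t → f (t • x) = t ^ 2 * f x)
    (f' : E → E →L[ℝ] ℝ) (hd : ∀ x, x ≠ 0 → HasFDerivAt f (f' x) x)
    (heuler : ∀ x, x ≠ 0 → f' x x = 2 * f x)
    (β : E →ₗ[ℝ] E →ₗ[ℝ] ℝ) (g : E → ℝ) (hg : ∀ x, x ≠ 0 → 0 < g x)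
    (h : ∀ x, x ≠ 0 → ∀ v, f' x v = g x * β x v) :
    (∀ x, x ≠ 0 → 0 < β x x) ∧ ∃ k, 0 < k ∧ ∀ x, f x = k * β x x := by
  have hβ : ∀ x, x ≠ 0 → 0 < β x x := by
    intro x hx
    have h1 := h x hx x
    rw [heuler x hx] at h1
    have h2 := hf x hx
    exact pos_of_mul_pos_right (by linarith) (hg x hx).le
  refine ⟨hβ, ?_⟩
  obtain ⟨u, v, hu, hv, huv, hspan⟩ := exists_orthonormal_pair hE β hβ
  have hβab : ∀ a b : ℝ, β (a • u + b • v) (a • u + b • v) = a ^ 2 + b ^ 2 := by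
    intro a b
    simp only [LinearMap.add_apply, LinearMap.smul_apply, map_add, map_smul, smul_eq_mul, hu, hv]
    linear_combination a * b * huv
  set γ : ℝ → E := fun θ => Real.cos θ • u + Real.sin θ • v with hγ
  have hγβ : ∀ θ, β (γ θ) (γ θ) = 1 := fun θ => by
    rw [hγ]; simp only [hβab]; exact Real.cos_sq_add_sin_sq θ
  have hγ0 : ∀ θ, γ θ ≠ 0 := by
    intro θ h0
    have := hγβ θ
    rw [h0] at this
    simp at this
  set c := β u v with hc
  -- Euler's identity and `β (γ θ) (γ θ) = 1` give `g = 2 f` on the ellipse, while `β (γ θ) (γ' θ)`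
  -- is the constant `c`.
  have hφ : ∀ θ, HasDerivAt (fun θ => f (γ θ)) (2 * c * f (γ θ)) θ := by
    intro θ
    have hγ' : HasDerivAt γ (-Real.sin θ • u + Real.cos θ • v) θ :=
      ((Real.hasDerivAt_cos θ).smul_const u).add ((Real.hasDerivAt_sin θ).smul_const v)
    have h1 := (hd _ (hγ0 θ)).comp_hasDerivAt θ hγ'
    have h2 : f' (γ θ) (-Real.sin θ • u + Real.cos θ • v) = 2 * c * f (γ θ) := by
      have h3 := heuler _ (hγ0 θ)
      rw [h _ (hγ0 θ), hγβ] at h3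
      rw [h _ (hγ0 θ)]
      have h4 : β (γ θ) (-Real.sin θ • u + Real.cos θ • v) = c := by
        simp only [hγ, LinearMap.add_apply, LinearMap.smul_apply, map_add, map_smul, smul_eq_mul,
          hu, hv]
        linear_combination c * Real.sin_sq_add_cos_sq θ - Real.sin θ ^ 2 * huv
      rw [h4]
      linear_combination c * h3
    rw [h2] at h1
    exact h1
  have hconst : ∀ θ, f (γ θ) * Real.exp (-(2 * c * θ)) = f (γ 0) := by
    intro θ
    have hder : ∀ θ, HasDerivAt (fun θ => f (γ θ) * Real.exp (-(2 * c * θ))) 0 θ := by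
      intro θ
      have h1 : HasDerivAt (fun θ : ℝ => -(2 * c * θ)) (-(2 * c)) θ := by
        simpa only [mul_one] using ((hasDerivAt_id' θ).const_mul (2 * c)).fun_neg
      exact ((hφ θ).mul h1.exp).congr_deriv (by ring)
    have := is_const_of_deriv_eq_zero (fun θ => (hder θ).differentiableAt)
      (fun θ => (hder θ).deriv) θ 0
    simpa using this
  -- `f ∘ γ` is a positive multiple of `exp (2 c θ)`, yet it is `2π`-periodic.
  have hc0 : c = 0 := by
    have h1 := hconst (2 * Real.pi)
    have h2 : γ (2 * Real.pi) = γ 0 := by simp [hγ]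
    rw [h2] at h1
    have h3 : Real.exp (-(2 * c * (2 * Real.pi))) = 1 :=
      mul_left_cancel₀ (hf _ (hγ0 0)).ne' (by rw [h1, mul_one])
    rw [Real.exp_eq_one_iff] at h3
    have := Real.pi_ne_zero
    simpa [this] using h3
  refine ⟨f (γ 0), hf _ (hγ0 0), fun x => ?_⟩
  obtain ⟨a, b, rfl⟩ := hspan x
  rw [hβab]
  set z : ℂ := ⟨a, b⟩ with hz
  have ha : ‖z‖ * Real.cos z.arg = a := Complex.norm_mul_cos_arg z
  have hb : ‖z‖ * Real.sin z.arg = b := Complex.norm_mul_sin_arg z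
  have hx : a • u + b • v = ‖z‖ • γ z.arg := by
    simp only [hγ, smul_add, smul_smul, ha, hb]
  have h1 := hconst z.arg
  rw [hc0] at h1
  simp only [mul_zero, zero_mul, neg_zero, Real.exp_zero, mul_one] at h1
  rw [hx, hhom _ _ (norm_nonneg z), h1, ← ha, ← hb]
  linear_combination -(‖z‖ ^ 2 * f (γ 0)) * Real.cos_sq_add_sin_sq z.arg

/-- If, for a scalar function `g`, every multiple `g x • μ x` of a linear form `μ` is obtained by
evaluating the covectors `f' x` at a fixed vector, then `f' x = g x • β x` for a bilinear `β`. -/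
theorem exists_bilin_of_forall_dual [FiniteDimensional ℝ E] (f' : E → E →L[ℝ] ℝ)
    (g : E → ℝ) (hg : ∀ x, x ≠ 0 → 0 < g x)
    (h : ∀ μ : Module.Dual ℝ E, ∃ w : E, ∀ x, x ≠ 0 → f' x w = g x * μ x) :
    ∃ β : E →ₗ[ℝ] E →ₗ[ℝ] ℝ, ∀ x, x ≠ 0 → ∀ v, f' x v = g x * β x v := by
  choose w hw using h
  let b := Module.finBasis ℝ (Module.Dual ℝ E)
  -- The chosen `w` need not be linear in `μ`; since the required identity is linear in `μ`, values
  -- on a basis suffice.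
  let A : Module.Dual ℝ E →ₗ[ℝ] E := b.constr ℝ (fun i => w (b i))
  have hA : ∀ μ x, x ≠ 0 → f' x (A μ) = g x * μ x := by
    intro μ x hx
    have : (f' x : E →ₗ[ℝ] ℝ) ∘ₗ A = g x • Module.Dual.eval ℝ E x := by
      refine b.ext fun i => ?_
      simp [A, b.constr_basis, hw (b i) x hx]
    exact LinearMap.congr_fun this μ
  have hinj : Function.Injective A := by
    rw [← LinearMap.ker_eq_bot, LinearMap.ker_eq_bot']
    intro μ hμ
    ext x
    by_cases hx : x = 0
    · simp [hx]
    · have := hA μ x hx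
      rw [hμ, map_zero] at this
      simpa [(hg x hx).ne'] using this.symm
  let e := LinearEquiv.ofInjectiveOfFinrankEq A hinj (Subspace.dual_finrank_eq)
  refine ⟨(e.symm : E →ₗ[ℝ] Module.Dual ℝ E).flip, fun x hx v => ?_⟩
  have := hA (e.symm v) x hx
  have hv : A (e.symm v) = v := e.apply_symm_apply v
  rw [hv] at this
  simpa using this

end PlaneLemma

/-! ### Shears of a plane and the first variation -/

section Hyperplane

variable {V : Type*} [NormedAddCommGroup V] [NormedSpace ℝ V]

theorem exists_eq_add_smul_of_notMem (hV : Module.finrank ℝ V = 3) {H : Submodule ℝ V}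
    (hH : Module.finrank ℝ H = 2) {τ : V} (hτ : τ ∉ H) (x : V) :
    ∃ y ∈ H, ∃ t : ℝ, x = y + t • τ := by
  have : Module.Finite ℝ V := Module.finite_of_finrank_pos (by omega)
  have hlt : H < H ⊔ Submodule.span ℝ {τ} :=
    lt_of_le_of_ne le_sup_left fun h =>
      hτ (h ▸ Submodule.mem_sup_right (Submodule.mem_span_singleton_self τ))
  have h1 := Submodule.finrank_lt_finrank_of_lt hlt
  have h2 := Submodule.finrank_le (H ⊔ Submodule.span ℝ {τ})
  have htop : H ⊔ Submodule.span ℝ {τ} = ⊤ :=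
    Submodule.eq_top_of_finrank_eq (by omega)
  have hx : x ∈ H ⊔ Submodule.span ℝ {τ} := by rw [htop]; trivial
  obtain ⟨y, hy, z, hz, rfl⟩ := Submodule.mem_sup.1 hx
  obtain ⟨t, rfl⟩ := Submodule.mem_span_singleton.1 hz
  exact ⟨y, hy, t, rfl⟩

theorem exists_eq_smul_add_smul_of_mem {H : Submodule ℝ V} (hH : Module.finrank ℝ H = 2)
    {u v : V} (hu : u ∈ H) (hv : v ∈ H) (h : LinearIndependent ℝ ![u, v]) {x : V} (hx : x ∈ H) :
    ∃ a b : ℝ, x = a • u + b • v := by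
  have h' : LinearIndependent ℝ ![(⟨u, hu⟩ : H), ⟨v, hv⟩] := by
    rw [LinearIndependent.pair_iff] at h ⊢
    exact fun a b hab => h a b (by simpa using congrArg Subtype.val hab)
  obtain ⟨a, b, hab⟩ := exists_eq_smul_add_smul_of_linearIndependent hH h' ⟨x, hx⟩
  exact ⟨a, b, by simpa using congrArg Subtype.val hab⟩

/-- The planes obtained from `H` by the shears `x ↦ x + s ν(x) τ` lie in any given neighbourhood of
`H` in the Grassmannian when `s` is small. -/
theorem Gr.eventually_exists_shear_mem {U : Set (Gr 2 V)} (hU : IsOpen U) {H : Gr 2 V}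
    (hH : H ∈ U) {u v : V} (hu : u ∈ H.1) (hv : v ∈ H.1) (huv : LinearIndependent ℝ ![u, v])
    {τ : V} (hτ : τ ∉ H.1) (ν : V →ₗ[ℝ] ℝ) :
    ∀ᶠ s in 𝓝 (0 : ℝ), ∃ K ∈ U, ∀ x ∈ H.1, x + (s * ν x) • τ ∈ K.1 := by
  have hli : ∀ s : ℝ,
      LinearIndependent ℝ ![u + (s * ν u) • τ, v + (s * ν v) • τ] := by
    intro s
    rw [LinearIndependent.pair_iff] at huv ⊢
    intro a b hab
    have h1 : (a • u + b • v) + (a * (s * ν u) + b * (s * ν v)) • τ = 0 := by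
      rw [← hab]; module
    have h2 : a * (s * ν u) + b * (s * ν v) = 0 := by
      by_contra h0
      refine hτ ((Submodule.smul_mem_iff _ h0).1 ?_)
      rw [eq_neg_of_add_eq_zero_right h1]
      exact H.1.neg_mem (H.1.add_mem (H.1.smul_mem _ hu) (H.1.smul_mem _ hv))
    rw [h2, zero_smul, add_zero] at h1
    exact huv a b h1
  let F : ℝ → {b : Fin 2 → V // LinearIndependent ℝ b} := fun s => ⟨_, hli s⟩
  have hF : Continuous F := by
    refine Continuous.subtype_mk (continuous_pi fun i => ?_) _
    fin_cases i
    · simpa using by fun_prop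
    · simpa using by fun_prop
  have hopen : IsOpen (F ⁻¹' (Gr.ofFrame ⁻¹' U)) := (isOpen_coinduced.1 hU).preimage hF
  have hF0 : Gr.ofFrame (F 0) = H := by
    have : Module.Finite ℝ H.1 := Module.finite_of_finrank_pos (by rw [H.2]; omega)
    refine Subtype.ext (Submodule.eq_of_le_of_finrank_eq ?_ ?_)
    · simp only [Gr.ofFrame, F, Submodule.span_le]
      rintro _ ⟨i, rfl⟩
      fin_cases i <;> simpa
    · rw [(Gr.ofFrame (F 0)).2, H.2]
  filter_upwards [hopen.mem_nhds (show F 0 ∈ Gr.ofFrame ⁻¹' U by simpa [hF0] using hH)] with s hs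
  refine ⟨_, hs, fun x hx => ?_⟩
  obtain ⟨a, b, rfl⟩ := exists_eq_smul_add_smul_of_mem H.2 hu hv huv hx
  have h1 : (a • u + b • v) + (s * ν (a • u + b • v)) • τ
      = a • (u + (s * ν u) • τ) + b • (v + (s * ν v) • τ) := by
    simp only [map_add, map_smul, smul_eq_mul]
    module
  rw [h1]
  exact Submodule.add_mem _ (Submodule.smul_mem _ _ (Submodule.subset_span ⟨0, rfl⟩))
    (Submodule.smul_mem _ _ (Submodule.subset_span ⟨1, rfl⟩))

/-- First variation: if the covectors `f'` along each sheared plane `{x + s ν(x) τ : x ∈ H}` have a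
common kernel vector, and `τ` is one for `s = 0`, then the derivative of `f'` in the direction
`τ` is, on `H`, controlled by the evaluation of `f'` at a fixed vector. -/
theorem exists_apply_eq_fderiv_mul (hV : Module.finrank ℝ V = 3) {H : Submodule ℝ V}
    (hH : Module.finrank ℝ H = 2) {τ : V} (hτ : τ ∉ H) {f' : V → V →L[ℝ] ℝ}
    (hd : ∀ x, x ≠ 0 → DifferentiableAt ℝ f' x) (hτ' : ∀ x ∈ H, x ≠ 0 → f' x τ = 0)
    {u v : V} (hu : u ∈ H) (hv : v ∈ H) (huv : LinearIndependent ℝ ![u, v])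
    (huu : f' u u ≠ 0) (hvv : f' v v ≠ 0) (h0 : f' u v = 0) (ν : V →ₗ[ℝ] ℝ)
    (h : ∀ᶠ s in 𝓝 (0 : ℝ), ∃ t : V, t ≠ 0 ∧ ∀ x ∈ H, x ≠ 0 → f' (x + (s * ν x) • τ) t = 0) :
    ∃ w ∈ H, ∀ x ∈ H, x ≠ 0 → f' x w = fderiv ℝ f' x τ τ * ν x := by
  have hu0 : u ≠ 0 := by rintro rfl; simp at huu
  have hv0 : v ≠ 0 := by rintro rfl; simp at hvv
  have hcurve : ∀ x, x ≠ 0 →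
      HasDerivAt (fun s : ℝ => f' (x + (s * ν x) • τ)) (ν x • fderiv ℝ f' x τ) 0 := by
    intro x hx
    have h1 : HasDerivAt (fun s : ℝ => x + (s * ν x) • τ) (ν x • τ) 0 := by
      simpa using (((hasDerivAt_id' (0 : ℝ)).mul_const (ν x)).smul_const τ).const_add x
    have h2 : HasFDerivAt f' (fderiv ℝ f' x) (x + ((0 : ℝ) * ν x) • τ) := by
      simpa using (hd x hx).hasFDerivAt
    simpa [Function.comp_def] using h2.comp_hasDerivAt (0 : ℝ) h1
  set α : ℝ → V →L[ℝ] ℝ := fun s => f' (u + (s * ν u) • τ) with hα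
  set β : ℝ → V →L[ℝ] ℝ := fun s => f' (v + (s * ν v) • τ) with hβ
  have hαd : ∀ y : V, DifferentiableAt ℝ (fun s => α s y) 0 := fun y =>
    ((hcurve u hu0).differentiableAt).clm_apply (differentiableAt_const y)
  have hβd : ∀ y : V, DifferentiableAt ℝ (fun s => β s y) 0 := fun y =>
    ((hcurve v hv0).differentiableAt).clm_apply (differentiableAt_const y)
  have hα0 : α 0 = f' u := by simp [hα]
  have hβ0 : β 0 = f' v := by simp [hβ]
  -- `n s` is the cross product of `α s` and `β s` in the basis `u, v, τ`: a common kernel vector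
  -- differentiable in `s`, unlike the arbitrary `t` in `h`.
  set m : ℝ → ℝ := fun s => α s u * β s v - α s v * β s u with hm
  set n : ℝ → V := fun s => (α s v * β s τ - α s τ * β s v) • u +
    (α s τ * β s u - α s u * β s τ) • v + m s • τ with hn
  have hmd : DifferentiableAt ℝ m 0 :=
    ((hαd u).mul (hβd v)).sub ((hαd v).mul (hβd u))
  have hnd : DifferentiableAt ℝ n 0 :=
    (((((hαd v).mul (hβd τ)).sub ((hαd τ).mul (hβd v))).smul_const u).add
      ((((hαd τ).mul (hβd u)).sub ((hαd u).mul (hβd τ))).smul_const v)).add (hmd.smul_const τ)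
  have hm0 : m 0 ≠ 0 := by
    simp only [hm, hα0, hβ0, h0, zero_mul, sub_zero]
    exact mul_ne_zero huu hvv
  have hn0 : n 0 = m 0 • τ := by
    simp [hn, hα0, hβ0, hτ' u hu hu0, hτ' v hv hv0]
  have hker : ∀ᶠ s in 𝓝 (0 : ℝ), ∀ x ∈ H, x ≠ 0 → f' (x + (s * ν x) • τ) (n s) = 0 := by
    -- When `m s ≠ 0` the common kernel of `α s` and `β s` is a line, so the given `t` is
    -- proportional to `n s`.
    filter_upwards [h, hmd.continuousAt.eventually_ne hm0] with s ⟨t, ht0, ht⟩ hms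
    obtain ⟨y, hy, t₃, rfl⟩ := exists_eq_add_smul_of_notMem hV hH hτ t
    obtain ⟨t₁, t₂, rfl⟩ := exists_eq_smul_add_smul_of_mem hH hu hv huv hy
    have e1 : α s (t₁ • u + t₂ • v + t₃ • τ) = 0 := ht u hu hu0
    have e2 : β s (t₁ • u + t₂ • v + t₃ • τ) = 0 := ht v hv hv0
    simp only [map_add, map_smul, smul_eq_mul] at e1 e2
    have c1 : m s * t₁ = (α s v * β s τ - α s τ * β s v) * t₃ := by
      simp only [hm]; linear_combination β s v * e1 - α s v * e2
    have c2 : m s * t₂ = (α s τ * β s u - α s u * β s τ) * t₃ := by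
      simp only [hm]; linear_combination α s u * e2 - β s u * e1
    have ht3 : t₃ ≠ 0 := by
      rintro rfl
      rw [mul_zero] at c1 c2
      apply ht0
      rw [(mul_eq_zero.1 c1).resolve_left hms, (mul_eq_zero.1 c2).resolve_left hms]
      simp
    have hns : t₃ • n s = m s • (t₁ • u + t₂ • v + t₃ • τ) := by
      simp only [hn, smul_add, smul_smul, c1, c2]
      module
    intro x hx hx0
    have := congrArg (f' (x + (s * ν x) • τ)) hns
    rw [map_smul, map_smul, ht x hx hx0, smul_zero, smul_eq_mul] at this
    exact (mul_eq_zero.1 this).resolve_left ht3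
  have hvar : ∀ x ∈ H, x ≠ 0 → f' x (deriv n 0) = -(m 0 * (fderiv ℝ f' x τ τ * ν x)) := by
    intro x hx hx0
    have h1 := (hcurve x hx0).clm_apply hnd.hasDerivAt
    have h2 : (fun s : ℝ => f' (x + (s * ν x) • τ) (n s)) =ᶠ[𝓝 0] fun _ => 0 := by
      filter_upwards [hker] with s hs using hs x hx hx0
    have h3 := h1.unique ((hasDerivAt_const (0 : ℝ) (0 : ℝ)).congr_of_eventuallyEq h2)
    simp only [hn0, map_smul, zero_mul, zero_smul, add_zero, smul_apply,
      smul_eq_mul] at h3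
    linear_combination h3
  -- The `τ`-component can be dropped because `f' x τ = 0` on `H`.
  obtain ⟨w, hw, r, hwr⟩ := exists_eq_add_smul_of_notMem hV hH hτ (-(m 0)⁻¹ • deriv n 0)
  refine ⟨w, hw, fun x hx hx0 => ?_⟩
  have h1 := congrArg (f' x) hwr
  rw [map_smul, map_add, map_smul, hτ' x hx hx0, hvar x hx hx0, smul_zero, add_zero] at h1
  rw [← h1, smul_eq_mul]
  field_simp

end Hyperplane

/-! ### Differential calculus of `Φ ^ 2` -/

section BanachMinkowski

variable {V : Type*} [NormedAddCommGroup V] [NormedSpace ℝ V] {Φ : V → ℝ}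

namespace IsBanachMinkowskiNorm

theorem pos (hΦ : IsBanachMinkowskiNorm Φ) {v : V} (hv : v ≠ 0) : 0 < Φ v :=
  lt_of_le_of_ne (hΦ.nonneg v) fun h => hv ((hΦ.eq_zero_iff v).1 h.symm)

theorem sq_smul (hΦ : IsBanachMinkowskiNorm Φ) (t : ℝ) (v : V) (ht : 0 ≤ t) :
    Φ (t • v) ^ 2 = t ^ 2 * Φ v ^ 2 := by
  rw [hΦ.pos_homogeneous t v ht, mul_pow]

theorem contDiffAt_sq (hΦ : IsBanachMinkowskiNorm Φ) {v : V} (hv : v ≠ 0) :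
    ContDiffAt ℝ ∞ (fun x => Φ x ^ 2) v :=
  (hΦ.smooth.contDiffAt (isOpen_compl_singleton.mem_nhds hv)).pow 2

theorem hasFDerivAt_sq (hΦ : IsBanachMinkowskiNorm Φ) {v : V} (hv : v ≠ 0) :
    HasFDerivAt (fun x => Φ x ^ 2) (fderiv ℝ (fun x => Φ x ^ 2) v) v :=
  ((hΦ.contDiffAt_sq hv).differentiableAt (by simp)).hasFDerivAt

theorem differentiableAt_fderiv_sq (hΦ : IsBanachMinkowskiNorm Φ) {v : V} (hv : v ≠ 0) :
    DifferentiableAt ℝ (fderiv ℝ (fun x => Φ x ^ 2)) v :=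
  ((hΦ.contDiffAt_sq hv).fderiv_right (m := 1) (by norm_cast)).differentiableAt (by simp)

/-- Euler's identity, from differentiating `t ↦ Φ (t • v) ^ 2` at `t = 1`. -/
theorem fderiv_sq_apply_self (hΦ : IsBanachMinkowskiNorm Φ) {v : V} (hv : v ≠ 0) :
    fderiv ℝ (fun x => Φ x ^ 2) v v = 2 * Φ v ^ 2 := by
  have h1 : HasDerivAt (fun t : ℝ => t • v) v 1 := by
    simpa using (hasDerivAt_id' (1 : ℝ)).smul_const v
  have h2 : HasFDerivAt (fun x => Φ x ^ 2) (fderiv ℝ (fun x => Φ x ^ 2) v) ((1 : ℝ) • v) := by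
    simpa using hΦ.hasFDerivAt_sq hv
  have h3 := h2.comp_hasDerivAt (1 : ℝ) h1
  have h4 : HasDerivAt (fun t : ℝ => t ^ 2 * Φ v ^ 2) (2 * Φ v ^ 2) 1 := by
    simpa using (hasDerivAt_pow 2 (1 : ℝ)).mul_const (Φ v ^ 2)
  refine h3.unique (h4.congr_of_eventuallyEq ?_)
  filter_upwards [lt_mem_nhds (zero_lt_one' ℝ)] with t ht using hΦ.sq_smul t v ht.le

/-- A vector tangent to the unit sphere along `H` annihilates the differential of `Φ ^ 2`. -/
theorem fderiv_sq_apply_eq_zero (hΦ : IsBanachMinkowskiNorm Φ) {H : Submodule ℝ V} {τ : V}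
    (hτ : ∀ p ∈ (H : Set V) ∩ unitSphere Φ, IsTangentTo (unitSphere Φ) p τ) {x : V} (hx : x ∈ H)
    (hx0 : x ≠ 0) : fderiv ℝ (fun x => Φ x ^ 2) x τ = 0 := by
  have hpos := hΦ.pos hx0
  obtain ⟨c, hc0, hcS, hc⟩ := hτ ((Φ x)⁻¹ • x) ⟨H.smul_mem _ hx, by
    rw [unitSphere, Set.mem_ofPred_eq, hΦ.pos_homogeneous _ _ (inv_nonneg.2 hpos.le),
      inv_mul_cancel₀ hpos.ne']⟩
  -- Rescaling moves the curve from the unit sphere to the level set through `x`, where `Φ ^ 2` is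
  -- constant.
  have h1 : HasDerivAt (fun t => Φ x • c t) (Φ x • τ) 0 := hc.const_smul (Φ x)
  have h2 : HasFDerivAt (fun x => Φ x ^ 2) (fderiv ℝ (fun x => Φ x ^ 2) x) (Φ x • c 0) := by
    rw [hc0, smul_inv_smul₀ hpos.ne']
    exact hΦ.hasFDerivAt_sq hx0
  have h3 := h2.comp_hasDerivAt (0 : ℝ) h1
  have h4 := h3.unique ((hasDerivAt_const (0 : ℝ) (Φ x ^ 2)).congr_of_eventuallyEq (by
    filter_upwards [hcS] with t ht
    have : Φ (c t) = 1 := ht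
    simp [hΦ.sq_smul _ _ hpos.le, this]))
  rw [map_smul, smul_eq_mul] at h4
  exact (mul_eq_zero.1 h4).resolve_left hpos.ne'

/-- Every plane has a basis `u, v` with `v` in the kernel of the differential of `Φ ^ 2` at `u`. -/
theorem exists_linearIndependent_fderiv_sq_apply_eq_zero (hΦ : IsBanachMinkowskiNorm Φ)
    {H : Submodule ℝ V} (hH : Module.finrank ℝ H = 2) :
    ∃ u ∈ H, ∃ v ∈ H, LinearIndependent ℝ ![u, v] ∧ u ≠ 0 ∧ v ≠ 0 ∧
      fderiv ℝ (fun x => Φ x ^ 2) u v = 0 := by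
  have : Module.Finite ℝ H := Module.finite_of_finrank_pos (by omega)
  have : Nontrivial H := Module.nontrivial_of_finrank_pos (R := ℝ) (by omega)
  obtain ⟨u, hu0⟩ := exists_ne (0 : H)
  let L : H →ₗ[ℝ] ℝ := (fderiv ℝ (fun x => Φ x ^ 2) u : V →ₗ[ℝ] ℝ) ∘ₗ H.subtype
  have hker : LinearMap.ker L ≠ ⊥ := LinearMap.ker_ne_bot_of_finrank_lt (by simp [hH])
  obtain ⟨v, hv, hv0⟩ := Submodule.exists_mem_ne_zero_of_ne_bot hker
  have hu0' : (u : V) ≠ 0 := by simpa using hu0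
  have hv0' : (v : V) ≠ 0 := by simpa using hv0
  have hL : fderiv ℝ (fun x => Φ x ^ 2) u v = 0 := hv
  refine ⟨u, u.2, v, v.2, ?_, hu0', hv0', hL⟩
  rw [LinearIndependent.pair_iff]
  intro a b hab
  have ha : a = 0 := by
    have h1 := congrArg (fderiv ℝ (fun x => Φ x ^ 2) (u : V)) hab
    rw [map_add, map_smul, map_smul, hL, hΦ.fderiv_sq_apply_self hu0', smul_zero, add_zero,
      map_zero, smul_eq_mul] at h1
    have := hΦ.pos hu0'
    exact (mul_eq_zero.1 h1).resolve_right (by positivity)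
  subst ha
  rw [zero_smul, zero_add] at hab
  exact ⟨rfl, (smul_eq_zero.1 hab).resolve_right hv0'⟩

end IsBanachMinkowskiNorm

end BanachMinkowski

/-! ### Proof of the theorem -/

theorem propositionp {V : Type*} [NormedAddCommGroup V] [NormedSpace ℝ V]
    (hV : Module.finrank ℝ V = 3)
    (Φ : V → ℝ) (hΦ : IsBanachMinkowskiNorm Φ)
    (U : Set (Gr 2 V)) (hU : IsOpen U)
    (hτ : ∀ H ∈ U, ∃ τ : V, τ ≠ 0 ∧
      ∀ p ∈ (H.1 : Set V) ∩ unitSphere Φ, IsTangentTo (unitSphere Φ) p τ) :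
    ∀ H ∈ U, IsEuclideanNorm (fun x : H.1 => Φ (x : V)) := by
  intro H hHU
  obtain ⟨τ, hτ0, hτH⟩ := hτ H hHU
  have hfin : Module.Finite ℝ H.1 := Module.finite_of_finrank_pos (by rw [H.2]; omega)
  have hker : ∀ x ∈ H.1, x ≠ 0 → fderiv ℝ (fun x => Φ x ^ 2) x τ = 0 := fun x hx hx0 =>
    hΦ.fderiv_sq_apply_eq_zero hτH hx hx0
  have hτm : τ ∉ H.1 := by
    intro hm
    have h1 := hker τ hm hτ0
    rw [hΦ.fderiv_sq_apply_self hτ0] at h1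
    have := hΦ.pos hτ0
    exact absurd h1 (by positivity)
  obtain ⟨u, hu, v, hv, huv, hu0, hv0, hfuv⟩ :=
    hΦ.exists_linearIndependent_fderiv_sq_apply_eq_zero H.2
  have hself : ∀ x : V, x ≠ 0 → fderiv ℝ (fun x => Φ x ^ 2) x x ≠ 0 := fun x hx => by
    have := hΦ.pos hx
    rw [hΦ.fderiv_sq_apply_self hx]
    positivity
  set f' : H.1 → H.1 →L[ℝ] ℝ := fun x => (fderiv ℝ (fun x => Φ x ^ 2) (x : V)).comp H.1.subtypeL
    with hf'
  set g : H.1 → ℝ := fun x => fderiv ℝ (fderiv ℝ (fun x => Φ x ^ 2)) (x : V) τ τ with hg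
  have hgpos : ∀ x : H.1, x ≠ 0 → 0 < g x := fun x hx =>
    hΦ.strictly_convex x (by simpa using hx) τ hτ0
  obtain ⟨β, hβ⟩ := exists_bilin_of_forall_dual f' g hgpos (by
    intro μ
    obtain ⟨ν, hν⟩ := LinearMap.exists_extend μ
    obtain ⟨w, hw, hwx⟩ := exists_apply_eq_fderiv_mul hV H.2 hτm
      (fun x hx => hΦ.differentiableAt_fderiv_sq hx) hker hu hv huv (hself u hu0) (hself v hv0)
      hfuv ν (by
        filter_upwards [Gr.eventually_exists_shear_mem hU hHU hu hv huv hτm ν] with s hs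
        obtain ⟨K, hKU, hK⟩ := hs
        obtain ⟨t, ht0, ht⟩ := hτ K hKU
        refine ⟨t, ht0, fun x hx hx0 => hΦ.fderiv_sq_apply_eq_zero ht (hK x hx) fun h0 => ?_⟩
        by_cases hs : s * ν x = 0
        · rw [hs, zero_smul, add_zero] at h0
          exact hx0 h0
        · refine hτm ((Submodule.smul_mem_iff _ hs).1 ?_)
          rw [eq_neg_of_add_eq_zero_right h0]
          exact H.1.neg_mem hx)
    refine ⟨⟨w, hw⟩, fun x hx => ?_⟩
    rw [← hν]
    exact hwx x x.2 (by simpa using hx))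
  obtain ⟨hβpos, k, hk, hfk⟩ := eq_const_mul_of_fderiv_eq H.2 (f := fun x : H.1 => Φ (x : V) ^ 2)
    (fun x hx => pow_pos (hΦ.pos (by simpa using hx)) 2)
    (fun t x ht => hΦ.sq_smul t x ht) f'
    (fun x hx => (hΦ.hasFDerivAt_sq (v := (x : V)) (by simpa using hx)).comp x
      H.1.subtypeL.hasFDerivAt)
    (fun x hx => hΦ.fderiv_sq_apply_self (v := (x : V)) (by simpa using hx)) β g hgpos hβ
  -- Symmetrizing leaves the diagonal unchanged, so symmetry of `β` itself is never needed.
  refine ⟨(k / 2) • (β + β.flip), fun x y => ?_, fun x hx => ?_, fun x => ?_⟩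
  · simp only [LinearMap.smul_apply, LinearMap.add_apply, LinearMap.flip_apply, add_comm]
  · have := hβpos x hx
    simp only [LinearMap.smul_apply, LinearMap.add_apply, LinearMap.flip_apply, smul_eq_mul]
    positivity
  · have h1 : ((k / 2) • (β + β.flip)) x x = Φ (x : V) ^ 2 := by
      rw [hfk x]
      simp only [LinearMap.smul_apply, LinearMap.add_apply, LinearMap.flip_apply, smul_eq_mul]
      ring
    rw [h1, Real.sqrt_sq (hΦ.nonneg _)]
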